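/- Let $\{0,\dots,35\}$ carry the discrete topology and let $\mathbb Z^2$ act on the compact space $\{0,\dots,35\}^{\mathbb Z^2}$ by the left shift $(sx)_t=x_{t-s}$. A subshift is a closed shift-invariant subset of $\{0,\dots,35\}^{\mathbb Z^2}$; the set of all subshifts carries the Vietoris topology and the associated Borel $\sigma$-algebra. A function $x:\mathbb Z^2\to\{0,\dots,35\}$ is Toeplitz if it is continuous for the topology on $\mathbb Z^2$ generated by all cosets of finite index subgroups, and a subshift is Toeplitz if it is the closure of the $\mathbb Z^2$-orbit of a Toeplitz function. The topological full group $[[\mathbb Z^2\curvearrowright X]]$ of a subshift $X$ is the group of all homeomorphisms $T:X\to X$ for which there are a finite clopen partition $\{A_1,\dots,A_n\}$ of $X$ and $s_1,\dots,s_n\in\mathbb Z^2$ with $Tx=s_ix$ for all $i$ and all $x\in A_i$. Let $\mathrm{NAToepSubsh}(36^{\mathbb Z^2})$ be the space (with the subspace Borel structure) of all Toeplitz subshifts $X$ on which $\mathbb Z^2$ acts freely and whose topological full group $[[\mathbb Z^2\curvearrowright X]]$ is nonamenable (as a discrete group). Two subshifts $X,Y$ are continuously orbit equivalent if there are a homeomorphism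 $\Phi:X\to Y$ and continuous maps $\kappa:\mathbb Z^2\times X\to\mathbb Z^2$ and $\lambda:\mathbb Z^2\times Y\to\mathbb Z^2$ such that $\Phi(sx)=\kappa(s,x)\Phi(x)$ and $\Phi^{-1}(ty)=\lambda(t,y)\Phi^{-1}(y)$ for all $s,t\in\mathbb Z^2$, $x\in X$, $y\in Y$. Then the relation of continuous orbit equivalence on $\mathrm{NAToepSubsh}(36^{\mathbb Z^2})$ is not smooth: there are no standard Borel space $Z$ and Borel map $\varphi:\mathrm{NAToepSubsh}(36^{\mathbb Z^2})\to Z$ such that, for all $X,Y\in\mathrm{NAToepSubsh}(36^{\mathbb Z^2})$, the subshifts $X$ and $Y$ are continuously orbit equivalent if and only if $\varphi(X)=\varphi(Y)$. -/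

import Mathlib

open Set Topology SymbolicDynamics.FullShift

/-! ### Continuous orbit equivalence -/

/-- Two actions `G ↷ X` and `H ↷ Y` (written additively) are continuously orbit equivalent. -/
def ContOrbitEquiv (G X H Y : Type*) [AddGroup G] [TopologicalSpace G] [TopologicalSpace X]
    [AddAction G X] [AddGroup H] [TopologicalSpace H] [TopologicalSpace Y] [AddAction H Y] : Prop :=
  ∃ (Φ : X ≃ₜ Y) (κ : C(G × X, H)) (l : C(H × Y, G)),
    (∀ (s : G) (x : X), Φ (s +ᵥ x) = κ (s, x) +ᵥ Φ x) ∧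
    (∀ (t : H) (y : Y), Φ.symm (t +ᵥ y) = l (t, y) +ᵥ Φ.symm y)

section ContOrbitEquiv

variable {G X H Y K Z : Type*} [AddGroup G] [TopologicalSpace G] [TopologicalSpace X]
  [AddAction G X] [AddGroup H] [TopologicalSpace H] [TopologicalSpace Y] [AddAction H Y]
  [AddGroup K] [TopologicalSpace K] [TopologicalSpace Z] [AddAction K Z]

theorem ContOrbitEquiv.refl' : ContOrbitEquiv G X G X :=
  ⟨Homeomorph.refl X, ⟨Prod.fst, continuous_fst⟩, ⟨Prod.fst, continuous_fst⟩,
    fun _ _ => rfl, fun _ _ => rfl⟩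

theorem ContOrbitEquiv.symm' (h : ContOrbitEquiv G X H Y) : ContOrbitEquiv H Y G X := by
  obtain ⟨Φ, κ, l, h₁, h₂⟩ := h
  exact ⟨Φ.symm, l, κ, h₂, h₁⟩

theorem ContOrbitEquiv.trans' (h : ContOrbitEquiv G X H Y) (h' : ContOrbitEquiv H Y K Z) :
    ContOrbitEquiv G X K Z := by
  obtain ⟨Φ, κ, l, h₁, h₂⟩ := h
  obtain ⟨Φ', κ', l', h₁', h₂'⟩ := h'
  refine ⟨Φ.trans Φ', ⟨fun p => κ' (κ p, Φ p.2), by fun_prop⟩,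
    ⟨fun p => l (l' p, Φ'.symm p.2), by fun_prop⟩, fun s x => ?_, fun t z => ?_⟩
  · simp [h₁, h₁']
  · simp [h₂, h₂']

end ContOrbitEquiv

/-! ### Topological full groups and amenability -/

/-- `T` is given on each piece of a finite clopen partition of `X` by an element of `G`. -/
def IsPiecewiseAction (G : Type*) {X : Type*} [AddGroup G] [TopologicalSpace X] [AddAction G X]
    (T : X ≃ₜ X) : Prop :=
  ∃ (n : ℕ) (A : Fin n → Set X) (s : Fin n → G),
    (∀ i, IsClopen (A i)) ∧ Pairwise (fun i j => Disjoint (A i) (A j)) ∧ (⋃ i, A i) = univ ∧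
      ∀ i, ∀ x ∈ A i, T x = s i +ᵥ x

theorem IsPiecewiseAction.of_finite {G X ι : Type*} [AddGroup G] [TopologicalSpace X]
    [AddAction G X] [Finite ι] {T : X ≃ₜ X} (A : ι → Set X) (s : ι → G)
    (hc : ∀ i, IsClopen (A i)) (hd : Pairwise (fun i j => Disjoint (A i) (A j)))
    (hu : (⋃ i, A i) = univ) (hT : ∀ i, ∀ x ∈ A i, T x = s i +ᵥ x) : IsPiecewiseAction G T := by
  obtain ⟨n, ⟨e⟩⟩ := Finite.exists_equiv_fin ι
  refine ⟨n, fun i => A (e.symm i), fun i => s (e.symm i), fun i => hc _,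
    fun i j hij => hd (e.symm.injective.ne hij), ?_, fun i x hx => hT _ x hx⟩
  rw [← hu]
  exact e.symm.surjective.iUnion_comp A

/-- The topological full group of the action `G ↷ X`. -/
def topologicalFullGroup (G X : Type*) [AddGroup G] [TopologicalSpace X] [AddAction G X] :
    Subgroup (X ≃ₜ X) where
  carrier := {T | IsPiecewiseAction G T}
  one_mem' := .of_finite (ι := Unit) (fun _ => univ) (fun _ => 0) (fun _ => isClopen_univ)
    (fun i j h => (h (Subsingleton.elim i j)).elim) (iUnion_const _)
    (fun _ x _ => (zero_vadd G x).symm)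
  mul_mem' := by
    rintro S T ⟨m, B, t, hBc, hBd, hBu, hS⟩ ⟨n, A, s, hAc, hAd, hAu, hT⟩
    refine .of_finite (ι := Fin m × Fin n) (fun p => A p.2 ∩ T ⁻¹' B p.1)
      (fun p => t p.1 + s p.2) (fun p => (hAc _).inter ((hBc _).preimage T.continuous)) ?_ ?_ ?_
    · rintro ⟨i, j⟩ ⟨i', j'⟩ h
      by_cases hj : j = j'
      · have hi : i ≠ i' := fun hi => h (by rw [hi, hj])
        exact ((hBd hi).preimage T).mono inter_subset_right inter_subset_right
      · exact (hAd hj).mono inter_subset_left inter_subset_left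
    · refine eq_univ_of_forall fun x => ?_
      obtain ⟨j, hj⟩ := mem_iUnion.1 (hAu.symm ▸ mem_univ x : x ∈ ⋃ i, A i)
      obtain ⟨i, hi⟩ := mem_iUnion.1 (hBu.symm ▸ mem_univ (T x) : T x ∈ ⋃ i, B i)
      exact mem_iUnion.2 ⟨(i, j), hj, hi⟩
    · rintro ⟨i, j⟩ x ⟨hj, hi⟩
      rw [Homeomorph.mul_apply, hS i _ hi, hT j x hj, add_vadd]
  inv_mem' := by
    rintro T ⟨n, A, s, hAc, hAd, hAu, hT⟩
    refine .of_finite (fun i => T.symm ⁻¹' A i) (fun i => - s i)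
      (fun i => (hAc i).preimage T.symm.continuous) (fun i j h => (hAd h).preimage T.symm) ?_ ?_
    · rw [← preimage_iUnion, hAu, preimage_univ]
    · intro i y hy
      have h := hT i _ hy
      rw [T.apply_symm_apply] at h
      change T.symm y = _
      rw [eq_neg_vadd_iff, ← h]

/-- Amenability of a discrete group: there is a left invariant finitely additive probability
measure defined on all subsets. -/
def IsAmenableGroup (G : Type*) [Group G] : Prop :=
  ∃ m : Set G → ℝ, (∀ A, 0 ≤ m A) ∧ m univ = 1 ∧
    (∀ A B, Disjoint A B → m (A ∪ B) = m A + m B) ∧ ∀ (g : G) (A : Set G), m ((g * ·) '' A) = m A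

/-! ### The space of subshifts -/

section Subshift

variable {A G : Type*} [TopologicalSpace A] [AddGroup G]

/-- The left shift action `(s +ᵥ x) t = x (-s + t)` on the points of a subshift. -/
instance subshiftAddAction (X : Subshift A G) : AddAction G X.carrier where
  vadd s x := ⟨shift (-s) x.1, X.mapsTo (-s) x.2⟩
  zero_vadd x := Subtype.ext (by funext t; change x.1 (-0 + t) = x.1 t; simp)
  add_vadd r s x := Subtype.ext (by
    funext t
    change x.1 (-(r + s) + t) = x.1 (-s + (-r + t))
    rw [neg_add_rev, add_assoc])

theorem subshift_vadd_apply (X : Subshift A G) (s : G) (x : X.carrier) (t : G) :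
    (s +ᵥ x).1 t = x.1 (-s + t) := rfl

/-- The Vietoris topology on the space of subshifts. -/
instance subshiftTopology : TopologicalSpace (Subshift A G) :=
  .induced Subshift.carrier (TopologicalSpace.vietoris (G → A))

instance subshiftMeasurableSpace : MeasurableSpace (Subshift A G) := borel _

instance subshiftBorelSpace : BorelSpace (Subshift A G) := ⟨rfl⟩

/-- The shift action on `X` is free. -/
def IsFreeSubshift (X : Subshift A G) : Prop :=
  ∀ (s : G) (x : X.carrier), s +ᵥ x = x → s = 0

/-- The topology on `G` generated by all cosets of finite index subgroups. -/
@[reducible]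
def profiniteTopology (G : Type*) [AddGroup G] : TopologicalSpace G :=
  .generateFrom {U | ∃ (H : AddSubgroup G) (g : G), H.FiniteIndex ∧ U = (g + ·) '' (H : Set G)}

/-- A Toeplitz function: it is continuous for the profinite topology on `G`. -/
def IsToeplitzFunction (x : G → A) : Prop :=
  @Continuous G A (profiniteTopology G) _ x

/-- A Toeplitz subshift: the orbit closure of a Toeplitz function. -/
def IsToeplitzSubshift (X : Subshift A G) : Prop :=
  ∃ x : G → A, IsToeplitzFunction x ∧ X.carrier = closure (range fun s : G => shift (-s) x)

end Subshift

/-- The free Toeplitz `ℤ²`-subshifts on `n` symbols whose topological full group is nonamenable. -/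
def NAToepSubsh (n : ℕ) : Set (Subshift (Fin n) (ℤ × ℤ)) :=
  {X | IsToeplitzSubshift X ∧ IsFreeSubshift X ∧
    ¬ IsAmenableGroup (topologicalFullGroup (ℤ × ℤ) X.carrier)}

/-- Continuous orbit equivalence, as an equivalence relation on `NAToepSubsh n`. -/
def coeSetoid (n : ℕ) : Setoid (NAToepSubsh n) where
  r X Y := ContOrbitEquiv (ℤ × ℤ) X.1.carrier (ℤ × ℤ) Y.1.carrier
  iseqv := ⟨fun _ => .refl', .symm', .trans'⟩

/-! ### Smoothness -/

/-- An equivalence relation is smooth if some Borel map to a standard Borel space is a complete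
invariant for it. (Every standard Borel space is Borel isomorphic to one in `Type`.) -/
def IsSmoothEquivRel {X : Type*} [MeasurableSpace X] (E : Setoid X) : Prop :=
  ∃ (Y : Type) (_ : MeasurableSpace Y) (_ : StandardBorelSpace Y) (φ : X → Y),
    Measurable φ ∧ ∀ x₁ x₂, E x₁ x₂ ↔ φ x₁ = φ x₂

/-!
Let `K` be the compact group `ℕ → ZMod 2`. Every integer `j` has a level, the number of final digits
`1` in its ternary expansion, and a label in `ZMod 2`, which tells whether the next digit is `0` or
`2`. For `p : K` the bits `label j + p (level j)` form a one-dimensional Toeplitz sequence; the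
two-dimensional configuration of `p` repeats this bit along the row at height `j`, together with the
periodic repetition of a word that depends on the level of `j` only. Long windows of bits determine
`j` modulo `3 ^ n`, and all words occur, so the orbit closure `X p` is free.

The words are labels of horizontal edges. The swaps along edges of a given label are involutions in
the topological full group of `X p`, and moving the origin along a row that spells a reduced word
shows that the involutions of three labels generate a free product of three groups of order two,
which is not amenable.

Flipping the bits on one level is a block map, so `X p` and `X (p + δₙ)` are conjugate. As the `δₙ`
generate a dense subgroup of `K`, a Borel invariant of continuous orbit equivalence would be
constant almost everywhere on `K` by ergodicity. But `p ↦ X p` is continuous and injective, and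
continuous orbit equivalence classes of subshifts are countable: the cocycle, restricted to
generators, and the letter at the origin, both transported to a fixed subshift, determine the other
subshift.
-/

/-! ### Amenability -/

section Amenability

variable {G H : Type*} [Group G] [Group H]

/-- `f` is read off from the decomposition of `G` as the product of `ψ.range` and a right
transversal. -/
theorem exists_equivariant_of_injective {ψ : H →* G} (hψ : Function.Injective ψ) :
    ∃ f : G → H, ∀ h g, f (ψ h * g) = h * f g := by
  obtain ⟨T, hT, -⟩ := Subgroup.exists_isComplement_right ψ.range 1
  refine ⟨fun g => (MonoidHom.ofInjective hψ).symm (hT.equiv g).1, fun h g => ?_⟩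
  have hmul := hT.equiv_mul_left (MonoidHom.ofInjective hψ h) g
  rw [MonoidHom.ofInjective_apply] at hmul
  simp only [hmul, map_mul, MulEquiv.symm_apply_apply]

theorem IsAmenableGroup.of_injective (hG : IsAmenableGroup G) {ψ : H →* G}
    (hψ : Function.Injective ψ) : IsAmenableGroup H := by
  obtain ⟨m, m_nonneg, m_univ, m_union, m_mul⟩ := hG
  obtain ⟨f, hf⟩ := exists_equivariant_of_injective hψ
  refine ⟨fun A => m (f ⁻¹' A), fun A => m_nonneg _, m_univ,
    fun A B h => m_union _ _ (h.preimage f), fun h A => ?_⟩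
  refine (congrArg m (Set.ext fun g => ?_)).trans (m_mul (ψ h) (f ⁻¹' A))
  simp only [image_mul_left, mem_preimage, ← map_inv, hf]

/-- A left invariant mean gives mass at least `1 / 2` to a set containing a translate of its
complement, and there is no room for three disjoint such sets. -/
theorem not_isAmenableGroup_of_mul_compl_subset {S : Fin 3 → Set G}
    (hS : Pairwise fun i j => Disjoint (S i) (S j))
    (hmul : ∀ i, ∃ g : G, (g * ·) '' (S i)ᶜ ⊆ S i) : ¬ IsAmenableGroup G := by
  rintro ⟨m, m_nonneg, m_univ, m_union, m_mul⟩
  have m_mono {A B : Set G} (h : A ⊆ B) : m A ≤ m B := by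
    have := m_union A (B \ A) disjoint_sdiff_right
    rw [union_sdiff_cancel h] at this
    linarith [m_nonneg (B \ A)]
  have half_le (i : Fin 3) : 1 / 2 ≤ m (S i) := by
    obtain ⟨g, hg⟩ := hmul i
    have hcompl := m_union (S i) (S i)ᶜ disjoint_compl_right
    rw [union_compl_self, m_univ] at hcompl
    linarith [m_mono hg, m_mul g (S i)ᶜ]
  have h₁ := m_union (S 0) (S 1) (hS (by decide))
  have h₂ := m_union (S 0 ∪ S 1) (S 2)
    (disjoint_union_left.2 ⟨hS (by decide), hS (by decide)⟩)
  linarith [m_mono (subset_univ (S 0 ∪ S 1 ∪ S 2)), half_le 0, half_le 1, half_le 2]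

end Amenability

section FreeProduct

open Monoid.CoprodI

variable {ι : Type*}

open scoped Classical in
/-- The elements of a free product whose reduced word starts with a letter from `M i`. -/
def wordCone (M : ι → Type*) [∀ i, Group (M i)] (i : ι) : Set (Monoid.CoprodI M) :=
  {h | (Word.equiv h).fstIdx = some i}

theorem disjoint_wordCone (M : ι → Type*) [∀ i, Group (M i)] {i j : ι} (hij : i ≠ j) :
    Disjoint (wordCone M i) (wordCone M j) :=
  Set.disjoint_left.2 fun _ hi hj => hij (Option.some_inj.1 (hi.symm.trans hj))

theorem of_mul_mem_wordCone {M : ι → Type*} [∀ i, Group (M i)] {i : ι} {a : M i} (ha : a ≠ 1)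
    {h : Monoid.CoprodI M} (hh : h ∉ wordCone M i) : of a * h ∈ wordCone M i := by
  classical
  obtain ⟨w, rfl⟩ := Word.equiv.symm.surjective h
  have hw : w.fstIdx ≠ some i := by simpa [wordCone] using hh
  have hcons : of a * Word.equiv.symm w = Word.equiv.symm (Word.cons a w hw ha) :=
    (Word.prod_cons i a w ha hw).symm
  simp only [wordCone, mem_ofPred_eq, hcons, Equiv.apply_symm_apply, Word.fstIdx_cons]

theorem not_isAmenableGroup_coprodI (M : ι → Type*) [∀ i, Group (M i)] [∀ i, Nontrivial (M i)]
    (f : Fin 3 ↪ ι) : ¬ IsAmenableGroup (Monoid.CoprodI M) := by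
  refine not_isAmenableGroup_of_mul_compl_subset (S := fun i => wordCone M (f i))
    (fun i j hij => disjoint_wordCone M (f.injective.ne hij)) fun i => ?_
  obtain ⟨a, ha⟩ := exists_ne (1 : M (f i))
  exact ⟨of a, image_subset_iff.2 fun h hh => of_mul_mem_wordCone ha hh⟩

/-- The homomorphism from the group of order two that sends the generator to an involution. -/
def involutionHom {G : Type*} [Group G] (a : G) (ha : a * a = 1) : Multiplicative (ZMod 2) →* G :=
  AddMonoidHom.toMultiplicativeLeft <|
    ZMod.lift 2 ⟨(zmultiplesHom (Additive G)) (Additive.ofMul a), by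
      rw [zmultiplesHom_apply, natCast_zsmul, two_nsmul, ← ofMul_mul, ha, ofMul_one]⟩

theorem involutionHom_of_ne_one {G : Type*} [Group G] {a : G} (ha : a * a = 1)
    {x : Multiplicative (ZMod 2)} (hx : x ≠ 1) : involutionHom a ha x = a := by
  obtain rfl : x = Multiplicative.ofAdd 1 := by
    revert x; decide
  simpa [involutionHom] using congrArg Additive.toMul
    (ZMod.lift_coe 2 ⟨(zmultiplesHom (Additive G)) (Additive.ofMul a), _⟩ 1)

theorem not_isAmenableGroup_of_involutions {G : Type*} [Group G] {a : ι → G}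
    (ha : ∀ i, a i * a i = 1)
    (hword : ∀ l : List ι, l ≠ [] → l.IsChain (· ≠ ·) → (l.map a).prod ≠ 1) (f : Fin 3 ↪ ι) :
    ¬ IsAmenableGroup G := by
  classical
  let φ (i : ι) := involutionHom (a i) (ha i)
  suffices hφ : Function.Injective (lift φ) from
    fun hG => not_isAmenableGroup_coprodI (fun _ : ι => Multiplicative (ZMod 2)) f
      (hG.of_injective hφ)
  refine (injective_iff_map_eq_one _).2 fun h hh => ?_
  obtain ⟨w, rfl⟩ := Word.equiv.symm.surjective h
  have hprod : lift φ w.prod = ((w.toList.map Sigma.fst).map a).prod := by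
    rw [Word.prod, map_list_prod, List.map_map, List.map_map]
    congr 1
    refine List.map_congr_left fun x hx => ?_
    exact (lift_of ..).trans (involutionHom_of_ne_one (ha x.1) (w.ne_one x hx))
  by_contra hne
  refine hword (w.toList.map Sigma.fst) (fun hnil => hne ?_) ?_ (hprod.symm.trans hh)
  · rw [show w = Word.empty from Word.ext (List.map_eq_nil_iff.1 hnil)]
    exact Word.prod_empty
  · exact (List.isChain_map _).2 w.chain_ne

end FreeProduct

/-! ### Ternary digits -/

section Ternary

/-- The number of initial ternary digits of `j` equal to `1`. The digits are those of the `3`-adic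
expansion, and not all of them are `1` because `-1 / 2` is not an integer. -/
def ternaryLevel (j : ℤ) : ℕ :=
  if j % 3 = 1 then ternaryLevel (j / 3) + 1 else 0
termination_by j.natAbs
decreasing_by omega

/-- A binary label for the first ternary digit of `j` different from `1`: it is `0` for the digit
`0` and `1` for the digit `2`. -/
def ternaryLabel (j : ℤ) : ZMod 2 :=
  if j % 3 = 1 then ternaryLabel (j / 3) else if j % 3 = 0 then 0 else 1
termination_by j.natAbs
decreasing_by omega

theorem ternaryLevel_three_mul (k : ℤ) : ternaryLevel (3 * k) = 0 := by
  rw [ternaryLevel, if_neg (by omega)]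

theorem ternaryLevel_three_mul_add_two (k : ℤ) : ternaryLevel (3 * k + 2) = 0 := by
  rw [ternaryLevel, if_neg (by omega)]

theorem ternaryLevel_three_mul_add_one (k : ℤ) :
    ternaryLevel (3 * k + 1) = ternaryLevel k + 1 := by
  rw [ternaryLevel, if_pos (by omega), show (3 * k + 1) / 3 = k by omega]

theorem ternaryLabel_three_mul (k : ℤ) : ternaryLabel (3 * k) = 0 := by
  rw [ternaryLabel, if_neg (by omega), if_pos (by omega)]

theorem ternaryLabel_three_mul_add_two (k : ℤ) : ternaryLabel (3 * k + 2) = 1 := by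
  rw [ternaryLabel, if_neg (by omega), if_neg (by omega)]

theorem ternaryLabel_three_mul_add_one (k : ℤ) :
    ternaryLabel (3 * k + 1) = ternaryLabel k := by
  rw [ternaryLabel, if_pos (by omega), show (3 * k + 1) / 3 = k by omega]

@[elab_as_elim]
theorem ternary_induction {P : ℤ → Prop} (zero : ∀ k, P (3 * k)) (two : ∀ k, P (3 * k + 2))
    (one : ∀ k, P k → P (3 * k + 1)) (j : ℤ) : P j := by
  induction j using ternaryLevel.induct with
  | case1 j hj ih => exact (by omega : 3 * (j / 3) + 1 = j) ▸ one _ ih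
  | case2 j hj =>
    rcases (by omega : 3 * (j / 3) = j ∨ 3 * (j / 3) + 2 = j) with h | h
    exacts [h ▸ zero _, h ▸ two _]

theorem exists_eq_of_ternaryLevel_pos {j : ℤ} (hj : 0 < ternaryLevel j) :
    ∃ k, j = 3 * k + 1 := by
  refine ⟨j / 3, ?_⟩
  by_contra hne
  rw [ternaryLevel, if_neg (by omega)] at hj
  exact hj.false

theorem exists_ternaryLevel_eq (n : ℕ) : ∃ j, ternaryLevel j = n := by
  induction n with
  | zero => exact ⟨_, ternaryLevel_three_mul 0⟩
  | succ n ih =>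
    obtain ⟨j, rfl⟩ := ih
    exact ⟨3 * j + 1, ternaryLevel_three_mul_add_one j⟩

theorem ternaryLevel_ternaryLabel_eq_of_modEq {n : ℕ} {i j : ℤ} (hi : ternaryLevel i < n)
    (hij : i ≡ j [ZMOD 3 ^ n]) :
    ternaryLevel j = ternaryLevel i ∧ ternaryLabel j = ternaryLabel i := by
  obtain ⟨k, rfl⟩ := Int.modEq_iff_add_fac.1 hij
  clear hij
  obtain ⟨n, rfl⟩ := Nat.exists_eq_succ_of_ne_zero (by omega : n ≠ 0)
  induction i using ternary_induction generalizing n with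
  | zero u =>
    rw [show 3 * u + 3 ^ (n + 1) * k = 3 * (u + 3 ^ n * k) by ring]
    simp only [ternaryLevel_three_mul, ternaryLabel_three_mul, and_self]
  | two u =>
    rw [show 3 * u + 2 + 3 ^ (n + 1) * k = 3 * (u + 3 ^ n * k) + 2 by ring]
    simp only [ternaryLevel_three_mul_add_two, ternaryLabel_three_mul_add_two, and_self]
  | one u ih =>
    rw [show 3 * u + 1 + 3 ^ (n + 1) * k = 3 * (u + 3 ^ n * k) + 1 by ring]
    simp only [ternaryLevel_three_mul_add_one, ternaryLabel_three_mul_add_one,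
      Nat.add_left_inj] at hi ⊢
    obtain ⟨n, rfl⟩ := Nat.exists_eq_succ_of_ne_zero (by omega : n ≠ 0)
    exact ih n (by omega)

theorem ternaryLevel_eq_iff_of_modEq {n : ℕ} {i j : ℤ} (hij : i ≡ j [ZMOD 3 ^ (n + 1)]) :
    ternaryLevel i = n ↔ ternaryLevel j = n := by
  constructor <;> rintro rfl
  · exact (ternaryLevel_ternaryLabel_eq_of_modEq (Nat.lt_succ_self _) hij).1
  · exact (ternaryLevel_ternaryLabel_eq_of_modEq (Nat.lt_succ_self _) hij.symm).1

theorem exists_modEq_ternaryLabel_eq_add_one (j : ℤ) :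
    ∃ i, j ≡ i [ZMOD 3 ^ ternaryLevel j] ∧ ternaryLevel i = ternaryLevel j ∧
      ternaryLabel i = ternaryLabel j + 1 := by
  induction j using ternary_induction with
  | zero u =>
    refine ⟨3 * u + 2, ?_⟩
    simp only [ternaryLevel_three_mul, ternaryLevel_three_mul_add_two, ternaryLabel_three_mul,
      ternaryLabel_three_mul_add_two, pow_zero, Int.modEq_one, zero_add, and_self]
  | two u =>
    refine ⟨3 * u, ?_⟩
    simp only [ternaryLevel_three_mul, ternaryLevel_three_mul_add_two, ternaryLabel_three_mul,
      ternaryLabel_three_mul_add_two, pow_zero, Int.modEq_one, true_and]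
    rfl
  | one u ih =>
    obtain ⟨i, hmod, hlevel, hlabel⟩ := ih
    refine ⟨3 * i + 1, ?_⟩
    simp only [ternaryLevel_three_mul_add_one, ternaryLabel_three_mul_add_one, hlevel, hlabel,
      pow_succ', and_self, and_true]
    exact hmod.mul_left'.add_right 1

theorem modEq_of_le_ternaryLevel {n : ℕ} {i j : ℤ} (hi : n ≤ ternaryLevel i)
    (hj : n ≤ ternaryLevel j) : i ≡ j [ZMOD 3 ^ n] := by
  induction n generalizing i j with
  | zero => simp only [pow_zero, Int.modEq_one]
  | succ n ih =>
    obtain ⟨u, rfl⟩ := exists_eq_of_ternaryLevel_pos (by omega : 0 < ternaryLevel i)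
    obtain ⟨v, rfl⟩ := exists_eq_of_ternaryLevel_pos (by omega : 0 < ternaryLevel j)
    simp only [ternaryLevel_three_mul_add_one, add_le_add_iff_right] at hi hj
    rw [pow_succ']
    exact (ih hi hj).mul_left'.add_right 1

theorem exists_ternaryLevel_add_eq (n : ℕ) (j : ℤ) :
    ∃ t : ℕ, t < 3 ^ (n + 1) ∧ ternaryLevel (j + t) = n := by
  obtain ⟨c, hc⟩ := exists_ternaryLevel_eq n
  have hpos : (0 : ℤ) < 3 ^ (n + 1) := by positivity
  obtain ⟨t, ht⟩ := Int.eq_ofNat_of_zero_le (Int.emod_nonneg (c - j) hpos.ne')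
  refine ⟨t, by exact_mod_cast ht ▸ Int.emod_lt_of_pos (c - j) hpos, ?_⟩
  refine (ternaryLevel_eq_iff_of_modEq (i := c) ?_).1 hc
  rw [← ht]
  simpa using ((Int.mod_modEq (c - j) (3 ^ (n + 1))).add_left j).symm

end Ternary

/-! ### Recognizability of the Toeplitz bits -/

section Recognizability

/-- The Toeplitz bit sequence with parameter `p`: the label of `j`, flipped when `p` is `1` at the
level of `j`. -/
def toeplitzBit (p : ℕ → ZMod 2) (j : ℤ) : ZMod 2 := ternaryLabel j + p (ternaryLevel j)

theorem toeplitzBit_three_mul (p : ℕ → ZMod 2) (k : ℤ) : toeplitzBit p (3 * k) = p 0 := by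
  rw [toeplitzBit, ternaryLabel_three_mul, ternaryLevel_three_mul, zero_add]

theorem toeplitzBit_three_mul_add_two (p : ℕ → ZMod 2) (k : ℤ) :
    toeplitzBit p (3 * k + 2) = 1 + p 0 := by
  rw [toeplitzBit, ternaryLabel_three_mul_add_two, ternaryLevel_three_mul_add_two]

theorem toeplitzBit_three_mul_add_one (p : ℕ → ZMod 2) (k : ℤ) :
    toeplitzBit p (3 * k + 1) = toeplitzBit (fun n => p (n + 1)) k := by
  rw [toeplitzBit, ternaryLabel_three_mul_add_one, ternaryLevel_three_mul_add_one, toeplitzBit]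

theorem exists_toeplitzBit_add_ne (p : ℕ → ZMod 2) (k : ℤ) :
    ∃ s < 5, ∃ t < 5, toeplitzBit p (k + (s : ℕ)) ≠ toeplitzBit p (k + (t : ℕ)) := by
  obtain ⟨u, s, hs, hu⟩ : ∃ (u : ℤ) (s : ℕ), s < 3 ∧ k + s = 3 * u :=
    ⟨(k + 2) / 3, ((-k) % 3).toNat, by omega, by omega⟩
  refine ⟨s, by omega, s + 2, by omega, ?_⟩
  rw [Nat.cast_add, ← add_assoc, hu, Nat.cast_two, toeplitzBit_three_mul,
    toeplitzBit_three_mul_add_two]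
  exact (add_ne_right.2 one_ne_zero).symm

theorem emod_three_eq_one_iff (p : ℕ → ZMod 2) (i : ℤ) :
    i % 3 = 1 ↔
      ∃ s < 5, ∃ t < 5, toeplitzBit p (i + 3 * (s : ℕ)) ≠ toeplitzBit p (i + 3 * (t : ℕ)) := by
  induction i using ternary_induction with
  | zero u =>
    have h (s : ℤ) : 3 * u + 3 * s = 3 * (u + s) := by ring
    simp only [h, toeplitzBit_three_mul]
    exact iff_of_false (by omega) (by simp)
  | two u =>
    have h (s : ℤ) : 3 * u + 2 + 3 * s = 3 * (u + s) + 2 := by ring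
    simp only [h, toeplitzBit_three_mul_add_two]
    exact iff_of_false (by omega) (by simp)
  | one u =>
    have h (s : ℤ) : 3 * u + 1 + 3 * s = 3 * (u + s) + 1 := by ring
    simp only [h, toeplitzBit_three_mul_add_one]
    exact iff_of_true (by omega) (exists_toeplitzBit_add_ne _ u)

theorem emod_three_eq_one_of_toeplitzBit_eq {p q : ℕ → ZMod 2} {i j : ℤ}
    (h : ∀ t : ℕ, t < 13 → toeplitzBit p (i + t) = toeplitzBit q (j + t)) (hi : i % 3 = 1) :
    j % 3 = 1 := by
  obtain ⟨s, hs, t, ht, hne⟩ := (emod_three_eq_one_iff p i).1 hi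
  refine (emod_three_eq_one_iff q j).2 ⟨s, hs, t, ht, ?_⟩
  have h₁ := h (3 * s) (by omega)
  have h₂ := h (3 * t) (by omega)
  push_cast at h₁ h₂
  rwa [← h₁, ← h₂]

/-- A length of windows of bits that determine a position modulo `3 ^ n`: a window of length `15`
contains a window of length `13` at a position of residue `1` modulo `3`. -/
def recognitionLength : ℕ → ℕ
  | 0 => 0
  | n + 1 => 3 * recognitionLength n + 15

theorem modEq_of_toeplitzBit_eq {n : ℕ} {p q : ℕ → ZMod 2} {i j : ℤ}
    (h : ∀ t : ℕ, t < recognitionLength n → toeplitzBit p (i + t) = toeplitzBit q (j + t)) :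
    i ≡ j [ZMOD 3 ^ n] := by
  induction n generalizing p q i j with
  | zero => simp only [pow_zero, Int.modEq_one]
  | succ n ih =>
    rw [recognitionLength] at h
    obtain ⟨r, hr, hir⟩ : ∃ r : ℕ, r < 3 ∧ (i + r) % 3 = 1 :=
      ⟨((1 - i) % 3).toNat, by omega, by omega⟩
    have hjr : (j + r) % 3 = 1 := emod_three_eq_one_of_toeplitzBit_eq (p := p) (q := q)
      (fun t ht => by simpa [add_assoc] using h (r + t) (by omega)) hir
    obtain ⟨u, hu⟩ : ∃ u, i + r = 3 * u + 1 := ⟨(i + r) / 3, by omega⟩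
    obtain ⟨v, hv⟩ : ∃ v, j + r = 3 * v + 1 := ⟨(j + r) / 3, by omega⟩
    have huv : u ≡ v [ZMOD 3 ^ n] :=
      ih (p := fun n => p (n + 1)) (q := fun n => q (n + 1)) fun t ht => by
        rw [← toeplitzBit_three_mul_add_one, ← toeplitzBit_three_mul_add_one,
          show 3 * (u + t) + 1 = i + (r + 3 * t : ℕ) by push_cast; linarith,
          show 3 * (v + t) + 1 = j + (r + 3 * t : ℕ) by push_cast; linarith]
        exact h _ (by omega)
    refine Int.ModEq.add_right_cancel' r ?_
    rw [hu, hv, pow_succ']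
    exact huv.mul_left'.add_right 1

/-- A window of width less than `3 ^ n` contains at most one position of level at least `n`. If the
bits differ there, they are made equal by moving to a position with the opposite label. -/
theorem exists_toeplitzBit_window_eq {p q : ℕ → ZMod 2} {n : ℕ} (hpq : ∀ k < n, p k = q k) {N : ℤ}
    (hN : 2 * N < 3 ^ n) (j : ℤ) : ∃ j' : ℤ, ∀ t : ℤ, |t| ≤ N →
      ternaryLevel (j' + t) = ternaryLevel (j + t) ∧
        toeplitzBit q (j' + t) = toeplitzBit p (j + t) := by
  by_cases! h : ∃ s : ℤ, |s| ≤ N ∧ q (ternaryLevel (j + s)) ≠ p (ternaryLevel (j + s))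
  swap
  · exact ⟨j, fun t ht => ⟨rfl, by rw [toeplitzBit, toeplitzBit, h t ht]⟩⟩
  obtain ⟨s, hs, hne⟩ := h
  have hlevel : n ≤ ternaryLevel (j + s) := not_lt.1 fun hlt => hne (hpq _ hlt).symm
  have hq : q (ternaryLevel (j + s)) = p (ternaryLevel (j + s)) + 1 := by
    generalize p (ternaryLevel (j + s)) = a at hne ⊢
    generalize q (ternaryLevel (j + s)) = b at hne ⊢
    revert a b; decide
  obtain ⟨i, hmod, hi_level, hi_label⟩ := exists_modEq_ternaryLabel_eq_add_one (j + s)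
  refine ⟨i - s, fun t ht => ?_⟩
  obtain rfl | hts := eq_or_ne t s
  · rw [sub_add_cancel, toeplitzBit, toeplitzBit, hi_level, hi_label, hq]
    exact ⟨rfl, by rw [add_add_add_comm, CharTwo.add_self_eq_zero, add_zero]⟩
  · have hlt : ternaryLevel (j + t) < n := by
      by_contra! hle
      have hdvd := (modEq_of_le_ternaryLevel hle hlevel).symm.dvd
      rw [add_sub_add_left_eq_sub] at hdvd
      exact hts (sub_eq_zero.1 (Int.eq_zero_of_abs_lt_dvd hdvd (by
        have := abs_sub t s
        omega)))
    have hmod' : j + t ≡ i - s + t [ZMOD 3 ^ ternaryLevel (j + s)] := by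
      have := hmod.add_right (t - s)
      rwa [show j + s + (t - s) = j + t by ring, show i + (t - s) = i - s + t by ring] at this
    have ⟨h₁, h₂⟩ := ternaryLevel_ternaryLabel_eq_of_modEq (hlt.trans_le hlevel) hmod'
    rw [toeplitzBit, toeplitzBit, h₁, h₂, hpq _ hlt]
    exact ⟨rfl, rfl⟩

end Recognizability

/-! ### Orbit closures -/

section OrbitClosure

variable {A G : Type*} [TopologicalSpace A] [AddGroup G]

instance subshiftContinuousConstVAdd (X : Subshift A G) : ContinuousConstVAdd G X.carrier where
  continuous_const_vadd s :=
    ((continuous_shift (-s)).comp continuous_subtype_val).subtype_mk _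

instance subshiftCompactSpace [CompactSpace A] (X : Subshift A G) : CompactSpace X.carrier :=
  isCompact_iff_compactSpace.1 X.isClosed.isCompact

/-- The orbit closure of a configuration. -/
def orbitClosure (x : G → A) : Subshift A G where
  carrier := closure (range fun s : G => shift (-s) x)
  isClosed := isClosed_closure
  mapsTo g := by
    refine MapsTo.closure ?_ (continuous_shift g)
    rintro _ ⟨s, rfl⟩
    exact ⟨-g + s, by funext t; simp [add_assoc]⟩

theorem mem_orbitClosure_iff [DiscreteTopology A] {x z : G → A} :
    z ∈ (orbitClosure x).carrier ↔ ∀ F : Finset G, ∃ q, ∀ t ∈ F, z t = x (q + t) := by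
  refine mem_closure_iff.trans ⟨fun h F => ?_, fun h o ho hz => ?_⟩
  · obtain ⟨_, hy, s, rfl⟩ := h _ (isOpen_cylinder F z) fun _ _ => rfl
    exact ⟨-s, fun t ht => (hy t ht).symm⟩
  · obtain ⟨I, u, hu, hI⟩ := isOpen_pi_iff.1 ho z hz
    obtain ⟨q, hq⟩ := h I
    refine ⟨shift (-(-q)) x, hI fun t ht => ?_, -q, rfl⟩
    rw [neg_neg, shift_apply, ← hq t ht]
    exact (hu t ht).2

theorem mem_orbitClosure_self (x : G → A) : x ∈ (orbitClosure x).carrier :=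
  subset_closure ⟨0, by funext t; simp⟩

theorem exists_window_of_vadd_eq_self [DiscreteTopology A] {x : G → A} {s : G}
    {y : (orbitClosure x).carrier} (hy : s +ᵥ y = y) (F : Finset G) :
    ∃ q, ∀ t ∈ F, x (q + t) = x (q + (-s + t)) := by
  classical
  obtain ⟨q, hq⟩ := mem_orbitClosure_iff.1 y.2 (F ∪ F.image (-s + ·))
  refine ⟨q, fun t ht => ?_⟩
  rw [← hq t (Finset.mem_union_left _ ht),
    ← hq _ (Finset.mem_union_right _ (Finset.mem_image_of_mem _ ht)), ← subshift_vadd_apply, hy]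

theorem mapsTo_orbitClosure {F : (G → A) → G → A} (hF : Continuous F)
    (hshift : ∀ s y, F (shift s y) = shift s (F y)) {x y : G → A} (hx : F x = y) :
    MapsTo F (orbitClosure x).carrier (orbitClosure y).carrier := by
  subst hx
  refine MapsTo.closure ?_ hF
  rintro _ ⟨s, rfl⟩
  exact ⟨s, (hshift _ _).symm⟩

theorem eqOn_id_orbitClosure [T2Space A] {F : (G → A) → G → A} (hF : Continuous F)
    (hshift : ∀ s y, F (shift s y) = shift s (F y)) {x : G → A} (hx : F x = x) :
    EqOn F id (orbitClosure x).carrier := by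
  refine EqOn.closure ?_ hF continuous_id
  rintro _ ⟨s, rfl⟩
  rw [hshift, hx, id]

theorem contOrbitEquiv_orbitClosure [T2Space A] [TopologicalSpace G] {F F' : (G → A) → G → A}
    (hF : Continuous F) (hF' : Continuous F') (hshift : ∀ s y, F (shift s y) = shift s (F y))
    (hshift' : ∀ s y, F' (shift s y) = shift s (F' y)) {x y : G → A} (hx : F x = y)
    (hy : F' y = x) :
    ContOrbitEquiv G (orbitClosure x).carrier G (orbitClosure y).carrier := by
  have hmaps := mapsTo_orbitClosure hF hshift hx
  have hmaps' := mapsTo_orbitClosure hF' hshift' hy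
  have hleft : EqOn (F' ∘ F) id (orbitClosure x).carrier :=
    eqOn_id_orbitClosure (hF'.comp hF) (fun s z => by simp only [Function.comp_apply, hshift,
      hshift']) (by rw [Function.comp_apply, hx, hy])
  have hright : EqOn (F ∘ F') id (orbitClosure y).carrier :=
    eqOn_id_orbitClosure (hF.comp hF') (fun s z => by simp only [Function.comp_apply, hshift,
      hshift']) (by rw [Function.comp_apply, hy, hx])
  let Φ : (orbitClosure x).carrier ≃ₜ (orbitClosure y).carrier :=
    { toFun := hmaps.restrict
      invFun := hmaps'.restrict
      left_inv := fun z => Subtype.ext (hleft z.2)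
      right_inv := fun z => Subtype.ext (hright z.2)
      continuous_toFun := hF.restrict hmaps
      continuous_invFun := hF'.restrict hmaps' }
  exact ⟨Φ, ⟨Prod.fst, continuous_fst⟩, ⟨Prod.fst, continuous_fst⟩,
    fun s z => Subtype.ext (hshift _ _), fun s z => Subtype.ext (hshift' _ _)⟩

variable {P : Type*} [TopologicalSpace P] {f : P → G → A}

theorem isClosed_setOf_mem_orbitClosure [DiscreteTopology A]
    (hf : ∀ p, ∀ F : Finset G, ∀ᶠ p' in 𝓝 p, ∀ q, ∃ q', ∀ t ∈ F, f p' (q + t) = f p (q' + t)) :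
    IsClosed {z : P × (G → A) | z.2 ∈ (orbitClosure (f z.1)).carrier} := by
  refine isOpen_compl_iff.1 (isOpen_iff_mem_nhds.2 fun ⟨p, z⟩ hz => ?_)
  simp only [mem_compl_iff, mem_ofPred_eq, mem_orbitClosure_iff, not_forall] at hz
  obtain ⟨F, hF⟩ := hz
  filter_upwards [prod_mem_nhds (hf p F) ((isOpen_cylinder F z).mem_nhds fun _ _ => rfl)]
  rintro ⟨p', z'⟩ ⟨hp', hz'⟩ hmem
  obtain ⟨q, hq⟩ := mem_orbitClosure_iff.1 hmem F
  obtain ⟨q', hq'⟩ := hp' q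
  exact hF ⟨q', fun t ht => by rw [← hq' t ht, ← hq t ht, hz' t ht]⟩

/-- Lower semicontinuity always holds; upper semicontinuity holds as soon as no new patterns appear
near any parameter. -/
theorem continuous_orbitClosure [DiscreteTopology A] [Finite A] (hcont : Continuous f)
    (hf : ∀ p, ∀ F : Finset G, ∀ᶠ p' in 𝓝 p, ∀ q, ∃ q', ∀ t ∈ F, f p' (q + t) = f p (q' + t)) :
    Continuous fun p => orbitClosure (f p) := by
  refine continuous_induced_rng.2 (continuous_generateFrom_iff.2 ?_)
  rintro _ (⟨U, hU, rfl⟩ | ⟨U, hU, rfl⟩) <;> rw [mem_ofPred_eq] at hU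
  · have hclosed := isClosedMap_fst_of_compactSpace _
      ((isClosed_setOf_mem_orbitClosure hf).inter (hU.isClosed_compl.preimage continuous_snd))
    convert hclosed.isOpen_compl using 1
    ext p
    simp [subset_def]
  · have hopen : IsOpen (⋃ s : G, (fun p => shift (-s) (f p)) ⁻¹' U) :=
      isOpen_iUnion fun s => hU.preimage ((continuous_shift (-s)).comp hcont)
    convert hopen using 1
    ext p
    simp only [mem_preimage, Function.comp_apply, mem_ofPred_eq, orbitClosure, mem_iUnion]
    rw [closure_inter_open_nonempty_iff hU]
    exact ⟨fun ⟨_, ⟨s, rfl⟩, h⟩ => ⟨s, h⟩, fun ⟨s, h⟩ => ⟨_, ⟨s, rfl⟩, h⟩⟩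

end OrbitClosure

/-! ### Involutions in the topological full group -/

section PiecewiseAction

variable {G X : Type*} [AddGroup G] [TopologicalSpace X] [AddAction G X]

theorem IsPiecewiseAction.of_isLocallyConstant {T : X ≃ₜ X} {c : X → G} (hc : IsLocallyConstant c)
    (hfin : (range c).Finite) (hT : ∀ x, T x = c x +ᵥ x) : IsPiecewiseAction G T := by
  have := hfin.to_subtype
  refine .of_finite (ι := range c) (fun s => c ⁻¹' {s.1}) Subtype.val
    (fun s => hc.isClopen_fiber s.1)
    (fun s t hst => (disjoint_singleton.2 (Subtype.val_injective.ne hst)).preimage c)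
    (eq_univ_of_forall fun x => mem_iUnion.2 ⟨⟨c x, mem_range_self x⟩, rfl⟩) ?_
  rintro ⟨_, x, rfl⟩ y (hy : c y = c x)
  rw [hT, hy]

theorem continuous_vadd_of_isLocallyConstant [ContinuousConstVAdd G X] {c : X → G}
    (hc : IsLocallyConstant c) : Continuous fun x => c x +ᵥ x :=
  continuous_iff_continuousAt.2 fun x =>
    (continuous_const_vadd (c x)).continuousAt.congr <|
      (hc.eventually_eq x).mono fun y hy => congrArg (· +ᵥ y) hy.symm

end PiecewiseAction

section EdgeSwap

variable {A G : Type*} [AddGroup G] {g : G} {S : Set A}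

/-- The edge from `q` to `q + g` is labelled by `S` in `y`, and its two neighbours in the coset
`q + ℤ g` are not. The label of the edge from `q` to `q + g` is read off from `y q`. -/
def IsActiveEdge (g : G) (S : Set A) (y : G → A) (q : G) : Prop :=
  y q ∈ S ∧ y (q - g) ∉ S ∧ y (q + g) ∉ S

open scoped Classical in
/-- The group element that moves the origin of `y` along the active edge at the origin, if there is
one. -/
noncomputable def edgeStep (g : G) (S : Set A) (y : G → A) : G :=
  if IsActiveEdge g S y 0 then -g else if IsActiveEdge g S y (-g) then g else 0

theorem edgeStep_of_isActiveEdge_zero {y : G → A} (h : IsActiveEdge g S y 0) :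
    edgeStep g S y = -g := if_pos h

theorem edgeStep_of_isActiveEdge_neg {y : G → A} (h : IsActiveEdge g S y (-g)) :
    edgeStep g S y = g :=
  (if_neg fun h₀ => h.2.2 (neg_add_cancel g ▸ h₀.1)).trans (if_pos h)

variable [TopologicalSpace A] {X : Subshift A G}

theorem isActiveEdge_vadd_iff {y : X.carrier} {s q : G} :
    IsActiveEdge g S (s +ᵥ y).1 q ↔ IsActiveEdge g S y.1 (-s + q) := by
  simp only [IsActiveEdge, subshift_vadd_apply, add_sub_assoc, add_assoc]

theorem edgeStep_vadd_vadd (y : X.carrier) :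
    edgeStep g S (edgeStep g S y.1 +ᵥ y).1 +ᵥ edgeStep g S y.1 +ᵥ y = y := by
  by_cases h₀ : IsActiveEdge g S y.1 0
  · rw [edgeStep_of_isActiveEdge_zero h₀, edgeStep_of_isActiveEdge_neg, vadd_neg_vadd]
    rwa [isActiveEdge_vadd_iff, neg_neg, add_neg_cancel]
  by_cases h₁ : IsActiveEdge g S y.1 (-g)
  · rw [edgeStep_of_isActiveEdge_neg h₁, edgeStep_of_isActiveEdge_zero, neg_vadd_vadd]
    rwa [isActiveEdge_vadd_iff, add_zero]
  · have h : edgeStep g S y.1 = 0 := (if_neg h₀).trans (if_neg h₁)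
    rw [h, zero_vadd, h, zero_vadd]

theorem finite_range_edgeStep (g : G) (S : Set A) (X : Subshift A G) :
    (range fun y : X.carrier => edgeStep g S y.1).Finite := by
  refine (toFinite {-g, g, 0}).subset ?_
  rintro _ ⟨y, rfl⟩
  simp only [edgeStep]
  split_ifs <;> simp

variable [DiscreteTopology A]

theorem isLocallyConstant_isActiveEdge (X : Subshift A G) (g : G) (S : Set A) (q : G) :
    IsLocallyConstant fun y : X.carrier => IsActiveEdge g S y.1 q := by
  have h_apply (t : G) : IsLocallyConstant fun y : X.carrier => y.1 t :=
    (IsLocallyConstant.iff_continuous _).2 ((continuous_apply t).comp continuous_subtype_val)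
  exact (h_apply q).comp₂ ((h_apply (q - g)).prodMk (h_apply (q + g)))
    fun a b => a ∈ S ∧ b.1 ∉ S ∧ b.2 ∉ S

theorem isLocallyConstant_edgeStep (X : Subshift A G) (g : G) (S : Set A) :
    IsLocallyConstant fun y : X.carrier => edgeStep g S y.1 := by
  classical
  exact (isLocallyConstant_isActiveEdge X g S 0).comp₂ (isLocallyConstant_isActiveEdge X g S (-g))
    fun P Q => if P then -g else if Q then g else 0

/-- The involution that moves every point along the active edge at its origin. -/
noncomputable def edgeSwap (X : Subshift A G) (g : G) (S : Set A) :
    topologicalFullGroup G X.carrier :=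
  let T : X.carrier ≃ₜ X.carrier :=
    { toFun y := edgeStep g S y.1 +ᵥ y
      invFun y := edgeStep g S y.1 +ᵥ y
      left_inv := edgeStep_vadd_vadd
      right_inv := edgeStep_vadd_vadd
      continuous_toFun := continuous_vadd_of_isLocallyConstant (isLocallyConstant_edgeStep X g S)
      continuous_invFun :=
        continuous_vadd_of_isLocallyConstant (isLocallyConstant_edgeStep X g S) }
  ⟨T, .of_isLocallyConstant (isLocallyConstant_edgeStep X g S) (finite_range_edgeStep g S X)
    fun _ => rfl⟩

theorem edgeSwap_apply (y : X.carrier) :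
    (edgeSwap X g S : X.carrier ≃ₜ X.carrier) y = edgeStep g S y.1 +ᵥ y := rfl

theorem edgeSwap_mul_self (X : Subshift A G) (g : G) (S : Set A) :
    edgeSwap X g S * edgeSwap X g S = 1 :=
  Subtype.ext (Homeomorph.ext edgeStep_vadd_vadd)

variable {ι : Type*}

theorem prod_edgeSwap_apply {S : ι → Set A} {l : List ι} {y : X.carrier}
    (hy : ∀ m (hm : m < l.length), IsActiveEdge g (S l[m]) y.1 (m • g)) :
    ((l.map fun i => edgeSwap X g (S i)).prod : X.carrier ≃ₜ X.carrier)
      (-(l.length • g) +ᵥ y) = y := by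
  induction l generalizing y with
  | nil => simp
  | cons k l ih =>
    have hk : IsActiveEdge g (S k) (-g +ᵥ y).1 (-g) := by
      have h₀ : IsActiveEdge g (S k) y.1 (0 • g) := hy 0 (Nat.succ_pos _)
      rwa [isActiveEdge_vadd_iff, neg_neg, add_neg_cancel, ← zero_nsmul g]
    have hl (m : ℕ) (hm : m < l.length) : IsActiveEdge g (S l[m]) (-g +ᵥ y).1 (m • g) := by
      rw [isActiveEdge_vadd_iff, neg_neg, ← succ_nsmul']
      exact hy (m + 1) (Nat.succ_lt_succ hm)
    rw [List.map_cons, List.prod_cons, Subgroup.coe_mul, Homeomorph.mul_apply, List.length_cons,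
      succ_nsmul', neg_add_rev, add_vadd, ih hl, edgeSwap_apply, edgeStep_of_isActiveEdge_neg hk,
      vadd_neg_vadd]

theorem not_isAmenableGroup_topologicalFullGroup (hX : IsFreeSubshift X)
    (hg : ¬ IsOfFinAddOrder g) (f : Fin 3 ↪ ι) (S : ι → Set A)
    (hword : ∀ l : List ι, l.IsChain (· ≠ ·) → ∃ y : X.carrier,
      ∀ m (hm : m < l.length), IsActiveEdge g (S l[m]) y.1 (m • g)) :
    ¬ IsAmenableGroup (topologicalFullGroup G X.carrier) := by
  refine not_isAmenableGroup_of_involutions (fun i => edgeSwap_mul_self X g (S i))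
    (fun l hne hchain hone => ?_) f
  obtain ⟨y, hy⟩ := hword l hchain
  have hfix : -(l.length • g) +ᵥ y = y := by
    simpa [hone] using prod_edgeSwap_apply hy
  exact hg (isOfFinAddOrder_iff_nsmul_eq_zero.2
    ⟨l.length, List.length_pos_iff.2 hne, neg_eq_zero.1 (hX _ _ hfix)⟩)

end EdgeSwap

/-! ### Countability of continuous orbit equivalence classes -/

section Countability

theorem discreteTopology_continuousMap (X D : Type*) [TopologicalSpace X] [CompactSpace X]
    [TopologicalSpace D] [DiscreteTopology D] : DiscreteTopology C(X, D) := by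
  refine discreteTopology_iff_isOpen_singleton.2 fun f => ?_
  have hfin : (range f).Finite := (isCompact_range f.continuous).finite_of_discrete
  have hopen : IsOpen (⋂ d ∈ range f, {g : C(X, D) | MapsTo g (f ⁻¹' {d}) {d}}) :=
    hfin.isOpen_biInter fun d _ => ContinuousMap.isOpen_setOfPred_mapsTo
      ((isClosed_discrete _).preimage f.continuous).isCompact (isOpen_discrete _)
  convert hopen using 1
  ext g
  simp only [mem_singleton_iff, mem_iInter, mem_ofPred_eq]
  refine ⟨?_, fun h => ContinuousMap.ext fun x => h (f x) ⟨x, rfl⟩ rfl⟩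
  rintro rfl d _ x hx
  exact hx

theorem countable_continuousMap (X D : Type*) [TopologicalSpace X] [CompactSpace X] [T2Space X]
    [SecondCountableTopology X] [TopologicalSpace D] [DiscreteTopology D] [Countable D] :
    Countable C(X, D) :=
  have := discreteTopology_continuousMap X D
  countable_of_Lindelof_of_discrete

theorem map_vadd_of_closure_eq_top {H X Y : Type*} [AddGroup H] [AddAction H X] [AddAction H Y]
    {S : Set H} (hS : AddSubgroup.closure S = ⊤) {Ψ : X → Y}
    (hΨ : ∀ s ∈ S, ∀ x, Ψ (s +ᵥ x) = s +ᵥ Ψ x) (h : H) (x : X) : Ψ (h +ᵥ x) = h +ᵥ Ψ x := by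
  have hmem : h ∈ AddSubgroup.closure S := hS ▸ AddSubgroup.mem_top h
  induction hmem using AddSubgroup.closure_induction generalizing x with
  | mem s hs => exact hΨ s hs x
  | zero => rw [zero_vadd, zero_vadd]
  | add g h _ _ hg hh => rw [add_vadd, hg, hh, add_vadd]
  | neg g _ hg => rw [eq_neg_vadd_iff, ← hg, vadd_neg_vadd]

variable {B G H X : Type*} [TopologicalSpace B] [AddGroup H]

theorem subshift_eq_of_equivariant {Y Z : Subshift B H} (Ψ : Y.carrier ≃ Z.carrier)
    (hΨ : ∀ (h : H) (y : Y.carrier), Ψ (h +ᵥ y) = h +ᵥ Ψ y)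
    (hzero : ∀ y, (Ψ y).1 0 = y.1 0) : Y = Z := by
  have hval (y : Y.carrier) : (Ψ y).1 = y.1 := funext fun t => by
    simpa [hΨ, subshift_vadd_apply] using hzero (-t +ᵥ y)
  have hcarrier : Y.carrier = Z.carrier := by
    rw [← Subtype.range_coe (s := Y.carrier), ← Subtype.range_coe (s := Z.carrier),
      ← Ψ.surjective.range_comp]
    exact congrArg range (funext fun y => (hval y).symm)
  cases Y
  cases Z
  cases hcarrier
  rfl

variable [AddGroup G] [TopologicalSpace G] [TopologicalSpace X] [AddAction G X]

/-- The subshift `Y` is a recoding of the action `G ↷ X`, where the element `s` of `S` acts by the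
piecewise translation `x ↦ c s x +ᵥ x`, and `b` is the letter at the origin. -/
def IsRecoding (S : Set H) (c : S → C(X, G)) (b : C(X, B)) (Y : Subshift B H) : Prop :=
  ∃ Φ : X ≃ Y.carrier, (∀ s x, Φ (c s x +ᵥ x) = s.1 +ᵥ Φ x) ∧ ∀ x, (Φ x).1 0 = b x

theorem IsRecoding.eq {S : Set H} (hS : AddSubgroup.closure S = ⊤) {c : S → C(X, G)} {b : C(X, B)}
    {Y Z : Subshift B H} (hY : IsRecoding S c b Y) (hZ : IsRecoding S c b Z) : Y = Z := by
  obtain ⟨Φ, hΦ, hΦb⟩ := hY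
  obtain ⟨Φ', hΦ', hΦb'⟩ := hZ
  refine subshift_eq_of_equivariant (Φ.symm.trans Φ')
    (map_vadd_of_closure_eq_top hS fun s hs y => ?_) fun y => ?_
  all_goals obtain ⟨x, rfl⟩ := Φ.surjective y
  · rw [← hΦ ⟨s, hs⟩ x]
    simp only [Equiv.trans_apply, Equiv.symm_apply_apply, hΦ']
  · simp only [Equiv.trans_apply, Equiv.symm_apply_apply, hΦb, hΦb']

theorem exists_isRecoding [TopologicalSpace H] (S : Set H) {Y : Subshift B H}
    (hY : ContOrbitEquiv G X H Y.carrier) :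
    ∃ (c : S → C(X, G)) (b : C(X, B)), IsRecoding S c b Y := by
  obtain ⟨Φ, -, l, -, hl⟩ := hY
  refine ⟨fun s => ⟨fun x => l (s.1, Φ x), by fun_prop⟩,
    ⟨fun x => (Φ x).1 0, (continuous_apply 0).comp (continuous_subtype_val.comp Φ.continuous)⟩,
    Φ.toEquiv, fun s x => ?_, fun x => rfl⟩
  have h := hl s.1 (Φ x)
  rw [Φ.symm_apply_apply] at h
  exact Φ.symm_apply_eq.1 h |>.symm

theorem countable_setOf_contOrbitEquiv [DiscreteTopology G] [Countable G] [CompactSpace X]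
    [T2Space X] [SecondCountableTopology X] [TopologicalSpace H] [AddGroup.FG H]
    [DiscreteTopology B] [Countable B] :
    {Y : Subshift B H | ContOrbitEquiv G X H Y.carrier}.Countable := by
  obtain ⟨S, hS, hfin⟩ := AddGroup.fg_iff.1 ‹AddGroup.FG H›
  have := hfin.to_subtype
  have := countable_continuousMap X G
  have := countable_continuousMap X B
  have hsub : {Y : Subshift B H | ContOrbitEquiv G X H Y.carrier} ⊆
      ⋃ d : (S → C(X, G)) × C(X, B), {Y | IsRecoding S d.1 d.2 Y} := fun Y hY => by
    obtain ⟨c, b, h⟩ := exists_isRecoding S hY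
    exact mem_iUnion.2 ⟨(c, b), h⟩
  refine (countable_iUnion fun d => Set.Subsingleton.countable ?_).mono hsub
  exact fun Y hY Z hZ => IsRecoding.eq hS (c := d.1) (b := d.2) hY hZ

end Countability

/-! ### A criterion for nonsmoothness -/

section Nonsmooth

theorem dense_of_forall_single_mem {ι : Type*} [DecidableEq ι] {M : ι → Type*}
    [∀ i, AddCommMonoid (M i)] [∀ i, TopologicalSpace (M i)] {N : AddSubmonoid (∀ i, M i)}
    (hN : ∀ i a, Pi.single i a ∈ N) : Dense (N : Set (∀ i, M i)) := by
  refine fun g => mem_closure_iff.2 fun U hU hg => ?_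
  obtain ⟨I, u, hu, hIU⟩ := isOpen_pi_iff.1 hU g hg
  refine ⟨∑ i ∈ I, Pi.single i (g i), hIU fun i hi => ?_, N.sum_mem fun i _ => hN i _⟩
  rw [Finset.sum_apply, Finset.sum_pi_single, if_pos (Finset.mem_coe.1 hi)]
  exact (hu i hi).2

theorem nhdsNE_zero_neBot_pi {M : ℕ → Type*} [∀ n, Zero (M n)] [∀ n, TopologicalSpace (M n)]
    [∀ n, Nontrivial (M n)] : (𝓝[≠] (0 : ∀ n, M n)).NeBot := by
  choose a ha using fun n => exists_ne (0 : M n)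
  refine mem_closure_iff_nhdsWithin_neBot.1 (mem_closure_of_tendsto
    (f := fun n => Pi.single n (a n)) (b := Filter.atTop)
    (tendsto_pi_nhds.2 fun k => tendsto_const_nhds.congr' ?_)
    (.of_forall fun n => Pi.single_eq_zero_iff.not.2 (ha n)))
  filter_upwards [Filter.eventually_gt_atTop k] with n hn
  rw [Pi.single_eq_of_ne hn.ne, Pi.zero_apply]

open MeasureTheory in
/-- By ergodicity, a function invariant under a dense set of translations is constant on a conull
set, and countable sets are null. -/
theorem exists_not_countable_preimage_singleton {K Y : Type*} [AddGroup K] [TopologicalSpace K]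
    [IsTopologicalAddGroup K] [CompactSpace K] [T2Space K] [SecondCountableTopology K]
    [MeasurableSpace K] [BorelSpace K] [(𝓝[≠] (0 : K)).NeBot] [MeasurableSpace Y]
    [MeasurableSpace.CountablySeparated Y] {f : K → Y} (hf : Measurable f)
    (hdense : Dense {g | ∀ p, f (g + p) = f p}) : ∃ y, ¬ (f ⁻¹' {y}).Countable := by
  let μ : Measure K := Measure.addHaar
  have : Nonempty Y := ⟨f 0⟩
  obtain ⟨y, hy⟩ := Filter.exists_eventuallyEq_const_of_forall_separating (l := ae μ) (f := f)
    MeasurableSet fun U hU => Filter.eventuallyConst_set.1 <|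
      aeconst_of_dense_setOfPred_preimage_vadd_eq (M := K) (μ := μ) (s := f ⁻¹' U)
        (hf hU).nullMeasurableSet <| hdense.mono fun g hg => Set.ext fun p => by
          change f (g + p) ∈ U ↔ f p ∈ U
          rw [show f (g + p) = f p from hg p]
  refine ⟨y, fun hcount => ?_⟩
  have hnull := measure_union_null (hcount.measure_zero μ) (show μ (f ⁻¹' {y})ᶜ = 0 from hy)
  rw [union_compl_self, Measure.measure_univ_eq_zero] at hnull
  exact NeZero.ne μ hnull

variable {K X : Type*} [AddGroup K] {E : Setoid X} {r : K → X}

/-- The translations of `K` that preserve the `E`-class of `r p` for every `p`. -/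
def classStabilizer (E : Setoid X) (r : K → X) : AddSubmonoid K where
  carrier := {g | ∀ p, E (r (g + p)) (r p)}
  zero_mem' p := by rw [zero_add]
  add_mem' {g h} hg hh p := by
    rw [add_assoc]
    exact E.trans' (hg _) (hh p)

theorem not_isSmoothEquivRel_of_dense [TopologicalSpace K] [IsTopologicalAddGroup K]
    [CompactSpace K] [T2Space K] [SecondCountableTopology K] [MeasurableSpace K] [BorelSpace K]
    [(𝓝[≠] (0 : K)).NeBot] [MeasurableSpace X] (hr : Measurable r) (hinj : Function.Injective r)
    (hcount : ∀ x, {y | E x y}.Countable) (hdense : Dense (classStabilizer E r : Set K)) :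
    ¬ IsSmoothEquivRel E := by
  rintro ⟨Y, _, _, φ, hφ, hE⟩
  have hinvariant : Dense {g | ∀ p, φ (r (g + p)) = φ (r p)} :=
    hdense.mono fun g (hg : ∀ p, E (r (g + p)) (r p)) p => (hE _ _).1 (hg p)
  obtain ⟨y, hy⟩ := exists_not_countable_preimage_singleton (hφ.comp hr) hinvariant
  obtain ⟨p, rfl⟩ : (φ ∘ r ⁻¹' {y}).Nonempty :=
    nonempty_iff_ne_empty.2 fun h => hy (h ▸ countable_empty)
  exact hy (((hcount (r p)).preimage hinj).mono fun q hq => (hE _ _).2 (Eq.symm hq))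

end Nonsmooth

/-! ### The Toeplitz configurations -/

section PeriodicRow

variable {κ : Type*}

/-- The periodic repetition over `ℤ` of the word `l` followed by a blank, which is encoded by
`none`. -/
def periodicRow (l : List κ) (i : ℤ) : Option κ := l[(i % (l.length + 1)).toNat]?

theorem periodicRow_eq_of_modEq {l : List κ} {i j : ℤ} (h : i ≡ j [ZMOD l.length + 1]) :
    periodicRow l i = periodicRow l j := by
  rw [periodicRow, periodicRow, h.eq]

theorem periodicRow_natCast {l : List κ} {m : ℕ} (hm : m ≤ l.length) :
    periodicRow l m = l[m]? := by
  rw [periodicRow, Int.emod_eq_of_lt (by omega) (by omega), Int.toNat_natCast]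

theorem periodicRow_eq_none_iff {l : List κ} {i : ℤ} :
    periodicRow l i = none ↔ i ≡ l.length [ZMOD l.length + 1] := by
  have hnonneg := Int.emod_nonneg i (by omega : (l.length + 1 : ℤ) ≠ 0)
  have hlt := Int.emod_lt_of_pos i (by omega : (0 : ℤ) < l.length + 1)
  rw [periodicRow, List.getElem?_eq_none_iff, Int.ModEq,
    Int.emod_eq_of_lt (Int.natCast_nonneg l.length) (lt_add_one _)]
  omega

theorem modEq_of_periodicRow_eq {l : List κ} {i j : ℤ}
    (h : ∀ t : ℕ, t ≤ l.length → periodicRow l (i + t) = periodicRow l (j + t)) :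
    i ≡ j [ZMOD l.length + 1] := by
  have hpos : (0 : ℤ) < l.length + 1 := by omega
  obtain ⟨t, ht⟩ := Int.eq_ofNat_of_zero_le (Int.emod_nonneg (l.length - i) hpos.ne')
  have hlt := ht ▸ Int.emod_lt_of_pos (l.length - i) hpos
  have hi : i + t ≡ l.length [ZMOD l.length + 1] := by
    rw [← ht]
    simpa using (Int.mod_modEq (l.length - i) (l.length + 1)).add_left i
  have hj := periodicRow_eq_none_iff.1 (h t (by omega) ▸ periodicRow_eq_none_iff.2 hi)
  exact (hi.trans hj.symm).add_right_cancel' t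

theorem periodicRow_sub_one_ne {l : List κ} (hl : l.IsChain (· ≠ ·)) {m : ℕ} (hm : m < l.length) :
    periodicRow l (m - 1) ≠ some l[m] := by
  obtain _ | m := m
  · rw [periodicRow_eq_none_iff.2 (Int.modEq_iff_dvd.2 (by simp))]
    exact Option.some_ne_none _ |>.symm
  · rw [show ((m + 1 : ℕ) - 1 : ℤ) = m by push_cast; ring, periodicRow_natCast (by omega),
      List.getElem?_eq_getElem (by omega)]
    exact (Option.some_injective _).ne (List.isChain_iff_getElem.1 hl m hm)

theorem periodicRow_add_one_ne {l : List κ} (hl : l.IsChain (· ≠ ·)) {m : ℕ} (hm : m < l.length) :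
    periodicRow l (m + 1) ≠ some l[m] := by
  rw [← Nat.cast_succ, periodicRow_natCast hm]
  by_cases h : m + 1 < l.length
  · rw [List.getElem?_eq_getElem h]
    exact (Option.some_injective _).ne (List.isChain_iff_getElem.1 hl m h).symm
  · rw [List.getElem?_eq_none (by omega)]
    exact Option.some_ne_none _ |>.symm

end PeriodicRow

theorem exists_le_length_of_surjective {α β : Type*} [Nonempty β] {f : α → List β}
    (hf : Function.Surjective f) (N : ℕ) : ∃ a, N ≤ (f a).length := by
  obtain ⟨a, ha⟩ := hf (List.replicate N (Classical.arbitrary β))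
  exact ⟨a, by rw [ha, List.length_replicate]⟩

section ToeplitzConfig

variable {κ A : Type*} (e : Option κ × ZMod 2 ↪ A) (w : ℕ → List κ) (p : ℕ → ZMod 2)

/-- The configuration whose row at height `j` repeats the word with number `ternaryLevel j` and
carries the Toeplitz bit of `j` with parameter `p`; pairs of a letter and a bit are encoded in the
alphabet by `e` and decoded by `Function.invFun e`. -/
def toeplitzConfig (q : ℤ × ℤ) : A :=
  e (periodicRow (w (ternaryLevel q.2)) q.1, toeplitzBit p q.2)

theorem invFun_toeplitzConfig (q : ℤ × ℤ) : Function.invFun e (toeplitzConfig e w p q) =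
    (periodicRow (w (ternaryLevel q.2)) q.1, toeplitzBit p q.2) :=
  Function.leftInverse_invFun e.injective _

variable {e w p}

theorem toeplitzConfig_eq_iff {p' : ℕ → ZMod 2} {q q' : ℤ × ℤ} :
    toeplitzConfig e w p q = toeplitzConfig e w p' q' ↔
      periodicRow (w (ternaryLevel q.2)) q.1 = periodicRow (w (ternaryLevel q'.2)) q'.1 ∧
        toeplitzBit p q.2 = toeplitzBit p' q'.2 := by
  rw [toeplitzConfig, toeplitzConfig, e.injective.eq_iff, Prod.mk.injEq]

/-- The symbols whose letter is `k`. -/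
def symbolsWithLetter (e : Option κ × ZMod 2 ↪ A) (k : κ) : Set A :=
  {a | (Function.invFun e a).1 = some k}

theorem toeplitzConfig_mem_symbolsWithLetter_iff {q : ℤ × ℤ} {k : κ} :
    toeplitzConfig e w p q ∈ symbolsWithLetter e k ↔
      periodicRow (w (ternaryLevel q.2)) q.1 = some k := by
  rw [symbolsWithLetter, mem_ofPred_eq, invFun_toeplitzConfig]

theorem isActiveEdge_toeplitzConfig {j : ℤ} (hj : (w (ternaryLevel j)).IsChain (· ≠ ·)) {m : ℕ}
    (hm : m < (w (ternaryLevel j)).length) :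
    IsActiveEdge (1, 0) (symbolsWithLetter e (w (ternaryLevel j))[m]) (toeplitzConfig e w p)
      (m, j) := by
  simp only [IsActiveEdge, toeplitzConfig_mem_symbolsWithLetter_iff, Prod.mk_add_mk,
    Prod.mk_sub_mk, add_zero, sub_zero]
  refine ⟨?_, periodicRow_sub_one_ne hj hm, periodicRow_add_one_ne hj hm⟩
  rw [periodicRow_natCast hm.le, List.getElem?_eq_getElem hm]

variable [TopologicalSpace A]

theorem isToeplitzFunction_toeplitzConfig : IsToeplitzFunction (toeplitzConfig e w p) := by
  let _ := profiniteTopology (ℤ × ℤ)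
  refine continuous_def.2 fun U _ => isOpen_iff_forall_mem_open.2 fun q hq => ?_
  let period : ℤ := (w (ternaryLevel q.2)).length + 1
  let H : AddSubgroup (ℤ × ℤ) := (AddSubgroup.zmultiples period).prod
    (AddSubgroup.zmultiples (3 ^ (ternaryLevel q.2 + 1)))
  have hH : H.FiniteIndex := by
    constructor
    rw [AddSubgroup.index_prod, Int.index_zmultiples, Int.index_zmultiples]
    exact mul_ne_zero (Int.natAbs_ne_zero.2 (by omega)) (Int.natAbs_ne_zero.2 (by positivity))
  refine ⟨(q + ·) '' (H : Set (ℤ × ℤ)), ?_, .basic _ ⟨H, q, hH, rfl⟩, 0, H.zero_mem, add_zero q⟩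
  rintro _ ⟨h, hh, rfl⟩
  have ⟨h₁, h₂⟩ := AddSubgroup.mem_prod.1 hh
  rw [Int.mem_zmultiples_iff] at h₁ h₂
  have ⟨hlevel, hlabel⟩ := ternaryLevel_ternaryLabel_eq_of_modEq (Nat.lt_succ_self _)
    (show q.2 ≡ (q + h).2 [ZMOD _] from Int.modEq_iff_dvd.2 (by simpa using h₂))
  have hrow : periodicRow (w (ternaryLevel q.2)) (q + h).1 =
      periodicRow (w (ternaryLevel q.2)) q.1 :=
    (periodicRow_eq_of_modEq (Int.modEq_iff_dvd.2 (by simpa using h₁))).symm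
  have heq : toeplitzConfig e w p (q + h) = toeplitzConfig e w p q :=
    toeplitzConfig_eq_iff.2 ⟨by rw [hlevel, hrow], by rw [toeplitzBit, toeplitzBit, hlevel, hlabel]⟩
  rwa [mem_preimage, heq]

section Free

variable [DiscreteTopology A] {s : ℤ × ℤ} {y : (orbitClosure (toeplitzConfig e w p)).carrier}

theorem snd_eq_zero_of_vadd_eq_self (hy : s +ᵥ y = y) : s.2 = 0 := by
  have hdvd (n : ℕ) : (3 : ℤ) ^ n ∣ s.2 := by
    obtain ⟨q, hq⟩ := exists_window_of_vadd_eq_self hy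
      ((Finset.range (recognitionLength n)).image fun t : ℕ => ((0 : ℤ), (t : ℤ)))
    have hmod : q.2 ≡ q.2 - s.2 [ZMOD 3 ^ n] := modEq_of_toeplitzBit_eq fun t ht => by
      rw [sub_eq_add_neg, add_assoc]
      exact (toeplitzConfig_eq_iff.1
        (hq _ (Finset.mem_image_of_mem _ (Finset.mem_range.2 ht)))).2
    simpa using hmod.dvd
  refine Int.eq_zero_of_abs_lt_dvd (hdvd s.2.natAbs) ?_
  rw [Int.abs_eq_natAbs]
  exact_mod_cast Nat.lt_pow_self (by norm_num)

theorem fst_eq_zero_of_vadd_eq_self (hw : ∀ N, ∃ n, N ≤ (w n).length) (hy : s +ᵥ y = y) :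
    s.1 = 0 := by
  obtain ⟨n, hn⟩ := hw s.1.natAbs
  obtain ⟨q, hq⟩ := exists_window_of_vadd_eq_self hy
    ((Finset.range ((w n).length + 1) ×ˢ Finset.range (3 ^ (n + 1))).image
      fun t : ℕ × ℕ => ((t.1 : ℤ), (t.2 : ℤ)))
  obtain ⟨t, ht, hlevel⟩ := exists_ternaryLevel_add_eq n q.2
  have hmod : q.1 ≡ q.1 - s.1 [ZMOD (w n).length + 1] := modEq_of_periodicRow_eq fun u hu => by
    have hut : (u, t) ∈ Finset.range ((w n).length + 1) ×ˢ Finset.range (3 ^ (n + 1)) :=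
      Finset.mem_product.2 ⟨Finset.mem_range.2 (Nat.lt_succ_of_le hu), Finset.mem_range.2 ht⟩
    have hrow := (toeplitzConfig_eq_iff.1 (hq _ (Finset.mem_image_of_mem _ hut))).1
    simp only [Prod.fst_add, Prod.snd_add, Prod.fst_neg, Prod.snd_neg,
      snd_eq_zero_of_vadd_eq_self hy, neg_zero, zero_add, hlevel] at hrow
    rwa [sub_eq_add_neg, add_assoc]
  refine Int.eq_zero_of_abs_lt_dvd (by simpa using hmod.dvd) ?_
  rw [Int.abs_eq_natAbs]
  omega

theorem isFreeSubshift_orbitClosure_toeplitzConfig (hw : ∀ N, ∃ n, N ≤ (w n).length) :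
    IsFreeSubshift (orbitClosure (toeplitzConfig e w p)) :=
  fun _ _ hy => Prod.ext (fst_eq_zero_of_vadd_eq_self hw hy) (snd_eq_zero_of_vadd_eq_self hy)

end Free

theorem not_isAmenableGroup_topologicalFullGroup_toeplitzConfig [DiscreteTopology A]
    (hw : Function.Surjective w) (f : Fin 3 ↪ κ) :
    ¬ IsAmenableGroup
      (topologicalFullGroup (ℤ × ℤ) (orbitClosure (toeplitzConfig e w p)).carrier) := by
  have : Nonempty κ := ⟨f 0⟩
  have hX : IsFreeSubshift (orbitClosure (toeplitzConfig e w p)) :=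
    isFreeSubshift_orbitClosure_toeplitzConfig (exists_le_length_of_surjective hw)
  have hg : ¬ IsOfFinAddOrder ((1, 0) : ℤ × ℤ) := fun h => by
    obtain ⟨m, hm, h0⟩ := isOfFinAddOrder_iff_nsmul_eq_zero.1 h
    exact hm.ne' (by simpa using congrArg Prod.fst h0)
  refine not_isAmenableGroup_topologicalFullGroup hX hg f (symbolsWithLetter e) fun l hl => ?_
  obtain ⟨n, rfl⟩ := hw l
  obtain ⟨j, rfl⟩ := exists_ternaryLevel_eq n
  refine ⟨-((0, j) : ℤ × ℤ) +ᵥ ⟨toeplitzConfig e w p, mem_orbitClosure_self _⟩, fun m hm => ?_⟩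
  rw [isActiveEdge_vadd_iff]
  simpa using isActiveEdge_toeplitzConfig hl hm

end ToeplitzConfig

/-! ### Varying the parameter -/

section Parameter

variable {κ A : Type*} {e : Option κ × ZMod 2 ↪ A} {w : ℕ → List κ} {n : ℕ}

/-- Above `q`, the bits of `y` look like the bits above an integer of level `n` in some Toeplitz
bit sequence. -/
def LooksLikeLevel (e : Option κ × ZMod 2 ↪ A) (n : ℕ) (y : ℤ × ℤ → A) (q : ℤ × ℤ) : Prop :=
  ∃ (p : ℕ → ZMod 2) (j : ℤ), ternaryLevel j = n ∧ ∀ t : ℕ, t < recognitionLength (n + 1) →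
    (Function.invFun e (y (q + (0, (t : ℤ))))).2 = toeplitzBit p (j + t)

theorem looksLikeLevel_shift_iff {y : ℤ × ℤ → A} {s q : ℤ × ℤ} :
    LooksLikeLevel e n (shift s y) q ↔ LooksLikeLevel e n y (s + q) := by
  simp only [LooksLikeLevel, shift_apply, add_assoc]

theorem looksLikeLevel_toeplitzConfig_iff {p : ℕ → ZMod 2} {q : ℤ × ℤ} :
    LooksLikeLevel e n (toeplitzConfig e w p) q ↔ ternaryLevel q.2 = n := by
  simp only [LooksLikeLevel, invFun_toeplitzConfig, Prod.snd_add]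
  refine ⟨?_, fun h => ⟨p, q.2, h, fun t _ => rfl⟩⟩
  rintro ⟨p', j, hj, h⟩
  exact (ternaryLevel_eq_iff_of_modEq (modEq_of_toeplitzBit_eq h)).2 hj

open scoped Classical in
/-- The block map that changes the bits in the rows that look like rows of level `n`. -/
noncomputable def flipLevel (e : Option κ × ZMod 2 ↪ A) (n : ℕ) (y : ℤ × ℤ → A) (q : ℤ × ℤ) : A :=
  if LooksLikeLevel e n y q then e (Prod.map id (· + 1) (Function.invFun e (y q))) else y q

theorem flipLevel_shift (s : ℤ × ℤ) (y : ℤ × ℤ → A) :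
    flipLevel e n (shift s y) = shift s (flipLevel e n y) := by
  classical
  exact funext fun q => if_congr looksLikeLevel_shift_iff rfl rfl

theorem flipLevel_toeplitzConfig (p : ℕ → ZMod 2) :
    flipLevel e n (toeplitzConfig e w p) = toeplitzConfig e w (p + Pi.single n 1) := by
  classical
  funext q
  rw [flipLevel, if_congr looksLikeLevel_toeplitzConfig_iff rfl rfl, invFun_toeplitzConfig]
  split_ifs with h
  · subst h
    rw [toeplitzConfig, toeplitzBit, toeplitzBit, Pi.add_apply, Pi.single_eq_same, ← add_assoc]
    rfl
  · rw [toeplitzConfig_eq_iff, toeplitzBit, toeplitzBit, Pi.add_apply, Pi.single_eq_of_ne h,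
      add_zero]
    exact ⟨rfl, rfl⟩

variable [TopologicalSpace A]

theorem continuous_toeplitzConfig : Continuous (toeplitzConfig e w) :=
  continuous_pi fun q => (continuous_of_discreteTopology
    (f := fun b => e (periodicRow (w (ternaryLevel q.2)) q.1, ternaryLabel q.2 + b))).comp
      (continuous_apply (ternaryLevel q.2))

variable [DiscreteTopology A]

theorem continuous_flipLevel : Continuous (flipLevel e n) := by
  classical
  refine continuous_pi fun q => ((IsLocallyConstant.iff_exists_open _).2 fun y => ?_).continuous
  let F : Finset (ℤ × ℤ) :=
    (Finset.range (recognitionLength (n + 1))).image fun t : ℕ => q + (0, (t : ℤ))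
  refine ⟨cylinder (insert q F) y, isOpen_cylinder _ _, fun _ _ => rfl, fun z hz => ?_⟩
  have hq : z q = y q := hz q (Finset.mem_insert_self _ _)
  have hF (t : ℕ) (ht : t < recognitionLength (n + 1)) :
      z (q + (0, (t : ℤ))) = y (q + (0, (t : ℤ))) :=
    hz _ (Finset.mem_insert_of_mem (Finset.mem_image_of_mem _ (Finset.mem_range.2 ht)))
  have hlooks : LooksLikeLevel e n z q ↔ LooksLikeLevel e n y q :=
    exists₂_congr fun _ _ => and_congr_right fun _ =>
      forall₂_congr fun t ht => by rw [hF t ht]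
  rw [flipLevel, flipLevel, hq, if_congr hlooks rfl rfl]

theorem contOrbitEquiv_toeplitzConfig_add_single (p : ℕ → ZMod 2) (n : ℕ) :
    ContOrbitEquiv (ℤ × ℤ) (orbitClosure (toeplitzConfig e w (p + Pi.single n 1))).carrier
      (ℤ × ℤ) (orbitClosure (toeplitzConfig e w p)).carrier := by
  have hcont : Continuous (flipLevel e n) := continuous_flipLevel
  refine contOrbitEquiv_orbitClosure hcont hcont flipLevel_shift flipLevel_shift ?_
    (flipLevel_toeplitzConfig p)
  rw [flipLevel_toeplitzConfig, add_assoc, ← Pi.single_add, CharTwo.add_self_eq_zero,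
    Pi.single_zero, add_zero]

theorem continuous_orbitClosure_toeplitzConfig [Finite A] :
    Continuous fun p => orbitClosure (toeplitzConfig e w p) := by
  refine continuous_orbitClosure continuous_toeplitzConfig fun p F => ?_
  obtain ⟨N, hN⟩ : ∃ N : ℤ, ∀ t ∈ F, |t.2| ≤ N := by
    obtain ⟨N, hN⟩ := (F.image fun t => |t.2|).exists_le
    exact ⟨N, fun t ht => hN _ (Finset.mem_image_of_mem _ ht)⟩
  obtain ⟨n, hn⟩ : ∃ n : ℕ, 2 * N < 3 ^ n := pow_unbounded_of_one_lt _ (by norm_num)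
  filter_upwards [(PiNat.isOpen_cylinder _ p n).mem_nhds (PiNat.self_mem_cylinder p n)]
    with p' hp' q
  obtain ⟨j, hj⟩ := exists_toeplitzBit_window_eq hp' hn q.2
  refine ⟨(q.1, j), fun t ht => ?_⟩
  have ⟨hlevel, hbit⟩ := hj t.2 (hN t ht)
  rw [toeplitzConfig_eq_iff, Prod.snd_add, Prod.snd_add, hlevel, hbit]
  exact ⟨rfl, rfl⟩

theorem injective_orbitClosure_toeplitzConfig :
    Function.Injective fun p => orbitClosure (toeplitzConfig e w p) := by
  intro p p' h
  have hmem : toeplitzConfig e w p ∈ (orbitClosure (toeplitzConfig e w p')).carrier :=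
    (congrArg Subshift.carrier h).subset (mem_orbitClosure_self _)
  funext n
  obtain ⟨c, hc⟩ := exists_ternaryLevel_eq n
  obtain ⟨q, hq⟩ := mem_orbitClosure_iff.1 hmem (insert (0, c)
    ((Finset.range (recognitionLength (n + 1))).image fun t : ℕ => ((0 : ℤ), (t : ℤ))))
  have hmod : 0 ≡ q.2 [ZMOD 3 ^ (n + 1)] := modEq_of_toeplitzBit_eq fun t ht => by
    rw [zero_add]
    exact (toeplitzConfig_eq_iff.1 (hq _ (Finset.mem_insert_of_mem
      (Finset.mem_image_of_mem _ (Finset.mem_range.2 ht))))).2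
  have ⟨hlevel, hlabel⟩ := ternaryLevel_ternaryLabel_eq_of_modEq (hc.trans_lt (Nat.lt_succ_self n))
    (show c ≡ q.2 + c [ZMOD _] by simpa using hmod.add_right c)
  have hbit : toeplitzBit p c = toeplitzBit p' (q.2 + c) :=
    (toeplitzConfig_eq_iff.1 (hq _ (Finset.mem_insert_self _ _))).2
  rw [toeplitzBit, toeplitzBit, hlevel, hlabel, hc] at hbit
  exact add_left_cancel hbit

end Parameter

/-! ### Nonsmoothness of continuous orbit equivalence -/

theorem orbitClosure_toeplitzConfig_mem_NAToepSubsh {κ : Type*} {n : ℕ}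
    (e : Option κ × ZMod 2 ↪ Fin n) {w : ℕ → List κ} (hw : Function.Surjective w) (f : Fin 3 ↪ κ)
    (p : ℕ → ZMod 2) : orbitClosure (toeplitzConfig e w p) ∈ NAToepSubsh n := by
  have : Nonempty κ := ⟨f 0⟩
  exact ⟨⟨_, isToeplitzFunction_toeplitzConfig, rfl⟩,
    isFreeSubshift_orbitClosure_toeplitzConfig (exists_le_length_of_surjective hw),
    not_isAmenableGroup_topologicalFullGroup_toeplitzConfig hw f⟩

theorem mainTheorem11_general (n : ℕ) (hn : 8 ≤ n) : ¬ IsSmoothEquivRel (coeSetoid n) := by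
  obtain ⟨e⟩ : Nonempty (Option (Fin 3) × ZMod 2 ↪ Fin n) :=
    Function.Embedding.nonempty_of_card_le (by simpa [ZMod.card] using hn)
  obtain ⟨w, hw⟩ := exists_surjective_nat (List (Fin 3))
  let r (p : ℕ → ZMod 2) : NAToepSubsh n :=
    ⟨orbitClosure (toeplitzConfig e w p), orbitClosure_toeplitzConfig_mem_NAToepSubsh e hw
      (Function.Embedding.refl _) p⟩
  have hr : Continuous r := continuous_orbitClosure_toeplitzConfig.subtype_mk _
  have hinj : Function.Injective r := fun p p' h =>
    injective_orbitClosure_toeplitzConfig (congrArg Subtype.val h)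
  have hcount (X : NAToepSubsh n) : {Y | coeSetoid n X Y}.Countable :=
    countable_setOf_contOrbitEquiv.preimage Subtype.val_injective
  have hsingle (k : ℕ) (a : ZMod 2) : Pi.single k a ∈ classStabilizer (coeSetoid n) r := by
    obtain rfl | rfl : a = 0 ∨ a = 1 := by revert a; decide
    · rw [Pi.single_zero]
      exact zero_mem _
    · intro p
      rw [add_comm]
      exact contOrbitEquiv_toeplitzConfig_add_single p k
  have := nhdsNE_zero_neBot_pi (M := fun _ => ZMod 2)
  exact not_isSmoothEquivRel_of_dense hr.measurable hinj hcount
    (dense_of_forall_single_mem hsingle)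

theorem mainTheorem11 : ¬ IsSmoothEquivRel (coeSetoid 36) :=
  mainTheorem11_general 36 (by norm_num)
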